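/- Let $\mathbb M$ be a connected smooth $d$-dimensional Riemannian manifold without boundary, with Riemannian distance $\mathrm{dist}$, open balls $B(x,r)$ and exponential maps $\mathrm{Exp}_z$. For a function $f$ and a set $S$ put $\|f\|_{C(S)}=\sup_{x\in S}|f(x)|\in[0,\infty]$, and $\|\nabla p\|_{C(S)}=\sup_{x\in S}\|\nabla p(x)\|$ with the dual Riemannian norm. **Assumption on $\varPi$.** $\varPi\subset C^1(\mathbb M)$ is a finite dimensional space of real functions and there are constants $\mathfrak D,\mathfrak M$ and $r^\sharp>0$ such that for all $p\in\varPi$, $0<r<r^\sharp$, $x_0\in\mathbb M$: $$\|p\|_{C(B(x_0,2r))}\le 2^{\mathfrak D}\|p\|_{C(B(x_0,r))},\qquad \|\nabla p\|_{C(B(x_0,r))}\le\frac{\mathfrak M}{r}\|p\|_{C(B(x_0,r))}.$$ **Assumption on $\Omega$.** $\Omega\subset\mathbb M$ is compact and there are $r^\flat>0$, $0<\omega<\pi/2$ such that for each $z\in\Omega$ there is a unit vector $v\in T_z\mathbb M$ with $\mathrm{Exp}_z(\{w\in T_z\mathbb M:\|w\|\le r^\flat,\ \langle v,w\rangle\ge\|w\|\cos\omega\})\subset\Omega$.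 **Constants.** Let $r_\Omega>0$ and $0<\Gamma_1\le\Gamma_2$ be such that for every $z\in\Omega$ the map $\mathrm{Exp}_z$ is defined on $\{w\in T_z\mathbb M:\|w\|<r_\Omega\}$, maps this ball diffeomorphically onto an open subset of $\mathbb M$, and satisfies $\Gamma_1\|x-y\|\le\mathrm{dist}(\mathrm{Exp}_z x,\mathrm{Exp}_z y)\le\Gamma_2\|x-y\|$ for all $x,y$ in it. Put $r^*=\min(r_\Omega,r^\sharp,r^\flat)$, $$A=\mathfrak M\,2^{2\mathfrak D}\Bigl(\frac{2+\sin\omega}{\Gamma_1\sin\omega}\Bigr)^{\mathfrak D},\qquad \kappa=A\,\frac{1+\Gamma_1\sin\omega}{\Gamma_1\sin\omega},$$ and assume that the constants are such that $\kappa\ge1$. Let $0<\epsilon<1$ and $h_0=\frac{\epsilon r^*}{(1+\epsilon)\kappa}$. **Lemma.** Let $\Xi\subset\Omega$ be finite and nonempty with fill distance $h=\max_{x\in\Omega}\mathrm{dist}(x,\Xi)\le h_0$, and let $\alpha\in\Omega$. Put $\Xi_{\alpha,\epsilon}=\Xi\cap B\bigl(\alpha,\tfrac{1+\epsilon}{\epsilon}\kappa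 h\bigr)$ and let $V_\alpha$ be the space of restrictions of functions in $\varPi$ to $B(\alpha,\kappa h)\cap\Omega$, with the uniform norm. 1. For every linear functional $\lambda\in V_\alpha'$ there is $\tilde a_\lambda$, supported in $\Xi_{\alpha,\epsilon}$, with $$\sum_{\xi\in\Xi}|\tilde a_\lambda(\xi)|\le(1-\epsilon)^{-1}\|\lambda\|_{V_\alpha'}\quad\text{and}\quad \sum_{\xi\in\Xi}\tilde a_\lambda(\xi)p(\xi)=\lambda\bigl(p|_{B(\alpha,\kappa h)\cap\Omega}\bigr)\ \text{ for all }p\in\varPi.$$ 2. In particular there is $a$, supported in $\Xi_{\alpha,\epsilon}$, with $\sum_\xi|a(\xi)|\le(1-\epsilon)^{-1}$ and $\sum_\xi a(\xi)p(\xi)=p(\alpha)$ for all $p\in\varPi$. 3. For every $v\in T_\alpha\mathbb M$ there is $a$, supported in $\Xi_{\alpha,\epsilon}$, with $\sum_\xi|a(\xi)|\le(1-\epsilon)^{-1}\frac{A}{\kappa h}\|v\|$ and $\sum_\xi a(\xi)p(\xi)=\nabla p(\alpha)v$ for all $p\in\varPi$. -/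

import Mathlib

open Set Manifold Bundle
open scoped ContDiff

noncomputable section

namespace LocalReproduction

/-! ### Geodesics, the exponential map and geodesic cones

`M` is a `d`-dimensional manifold without boundary, with a Riemannian metric on its tangent spaces;
its distance is (in the theorem) the Riemannian distance. -/

section Geometry

variable {d : ℕ} {M : Type*} [MetricSpace M] [ChartedSpace (EuclideanSpace ℝ (Fin d)) M]
  [IsManifold (𝓡 d) ∞ M] [RiemannianBundle (fun x : M => TangentSpace (𝓡 d) x)]

/-- `γ` restricted to `[0,1]` is a geodesic that starts at `x` with velocity `v`: it is smooth, has
constant speed `‖v‖`, and is locally length-minimizing, that is, the Riemannian distance of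
sufficiently close points of the curve is the length of the arc between them. -/
structure IsGeodesicFrom (γ : ℝ → M) (x : M) (v : TangentSpace (𝓡 d) x) : Prop where
  smooth : ContMDiffOn 𝓘(ℝ, ℝ) (𝓡 d) ∞ γ (Icc 0 1)
  start : γ 0 = x
  velocity : HasMFDerivWithinAt 𝓘(ℝ, ℝ) (𝓡 d) γ (Icc 0 1) 0
    ((1 : ℝ →L[ℝ] ℝ).smulRight (v : EuclideanSpace ℝ (Fin d)))
  minimizing : ∀ t ∈ Icc (0 : ℝ) 1, ∃ δ > 0, ∀ s ∈ Icc (0 : ℝ) 1, ∀ s' ∈ Icc (0 : ℝ) 1,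
    |s - t| < δ → |s' - t| < δ → dist (γ s) (γ s') = ‖v‖ * |s - s'|

/-- `Exp_x` is defined at `v`. -/
def ExpDefined (x : M) (v : TangentSpace (𝓡 d) x) : Prop :=
  ∃ γ : ℝ → M, IsGeodesicFrom γ x v

open Classical in
/-- The Riemannian exponential map: `Exp_x v = γ 1` for the geodesic `γ` from `x` with initial
velocity `v` (and `x` if there is no such geodesic on `[0,1]`). -/
def riemannianExp (x : M) (v : TangentSpace (𝓡 d) x) : M :=
  if hv : ExpDefined x v then hv.choose 1 else x

variable (d) in
/-- For every `z ∈ Ω`, the exponential map `Exp_z` is defined on the open ball `B(0,r)` of the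
tangent space at `z` and is a smooth diffeomorphism of this ball onto an open subset of `M`. -/
structure IsDiffeoRadius (Ω : Set M) (r : ℝ) : Prop where
  pos : 0 < r
  defined : ∀ z ∈ Ω, ∀ v ∈ Metric.ball (0 : TangentSpace (𝓡 d) z) r, ExpDefined z v
  injOn : ∀ z ∈ Ω, InjOn (riemannianExp z) (Metric.ball (0 : TangentSpace (𝓡 d) z) r)
  localDiffeo : ∀ z ∈ Ω, IsLocalDiffeomorphOn 𝓘(ℝ, TangentSpace (𝓡 d) z) (𝓡 d) ∞
    (riemannianExp z) (Metric.ball (0 : TangentSpace (𝓡 d) z) r)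

variable (d) in
/-- The metric equivalence
`Γ₁ |v - w| ≤ dist (Exp_z v, Exp_z w) ≤ Γ₂ |v - w|` for `z ∈ Ω` and `v, w ∈ B(0,r)`. -/
structure MetricEquivalence (Ω : Set M) (r Γ₁ Γ₂ : ℝ) : Prop where
  pos : 0 < Γ₁
  le : Γ₁ ≤ Γ₂
  lower : ∀ z ∈ Ω, ∀ v ∈ Metric.ball (0 : TangentSpace (𝓡 d) z) r,
    ∀ w ∈ Metric.ball (0 : TangentSpace (𝓡 d) z) r,
    Γ₁ * ‖v - w‖ ≤ dist (riemannianExp z v) (riemannianExp z w)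
  upper : ∀ z ∈ Ω, ∀ v ∈ Metric.ball (0 : TangentSpace (𝓡 d) z) r,
    ∀ w ∈ Metric.ball (0 : TangentSpace (𝓡 d) z) r,
    dist (riemannianExp z v) (riemannianExp z w) ≤ Γ₂ * ‖v - w‖

/-- The cone of radius `r`, aperture `θ` and axis `v` in the tangent space at `z`. -/
def tangentCone {z : M} (r θ : ℝ) (v : TangentSpace (𝓡 d) z) : Set (TangentSpace (𝓡 d) z) :=
  {w | ‖w‖ ≤ r ∧ ‖w‖ * Real.cos θ ≤ inner ℝ v w}

variable (d) in
/-- `Ω` is compact and satisfies an interior cone condition of radius `r` and aperture `θ`. -/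
structure InteriorConeDomain (Ω : Set M) (r θ : ℝ) : Prop where
  compact : IsCompact Ω
  radius_pos : 0 < r
  aperture_pos : 0 < θ
  aperture_lt : θ < Real.pi / 2
  cone : ∀ z ∈ Ω, ∃ v : TangentSpace (𝓡 d) z, ‖v‖ = 1 ∧ riemannianExp z '' tangentCone r θ v ⊆ Ω

/-! ### The function space -/

/-- The covariant derivative `∇p(x)` of a function, a covector at `x`; as an element of the dual of
the tangent space at `x` it carries the operator norm of the Riemannian norm. -/
def covDeriv (p : M → ℝ) (x : M) : TangentSpace (𝓡 d) x →L[ℝ] ℝ :=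
  mfderiv (𝓡 d) 𝓘(ℝ, ℝ) p x

/-- The uniform norm of `f` on `S`, with values in `[0,∞]`. -/
def supNorm {X : Type*} (f : X → ℝ) (S : Set X) : ENNReal := ⨆ x ∈ S, ‖f x‖ₑ

variable (d) in
/-- `P` is a finite dimensional space of `C¹` functions on `M` that satisfies, for balls of radius
less than `rs`, the doubling condition with exponent `D` and the Markov inequality with
constant `K`. -/
structure DoublingMarkovSpace (P : Submodule ℝ (M → ℝ)) (D K rs : ℝ) : Prop where
  finiteDimensional : FiniteDimensional ℝ P
  contMDiff : ∀ p ∈ P, ContMDiff (𝓡 d) 𝓘(ℝ, ℝ) 1 p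
  radius_pos : 0 < rs
  doubling : ∀ p ∈ P, ∀ r, 0 < r → r < rs → ∀ x₀ : M,
    supNorm p (Metric.ball x₀ (2 * r)) ≤
      ENNReal.ofReal ((2 : ℝ) ^ D) * supNorm p (Metric.ball x₀ r)
  markov : ∀ p ∈ P, ∀ r, 0 < r → r < rs → ∀ x₀ : M,
    ⨆ x ∈ Metric.ball x₀ r, ‖covDeriv (d := d) p x‖ₑ ≤
      ENNReal.ofReal (K / r) * supNorm p (Metric.ball x₀ r)

end Geometry

/-- The space of restrictions to `S` of the functions in `P`. -/
def restrictedSpace {X : Type*} (P : Submodule ℝ (X → ℝ)) (S : Set X) : Submodule ℝ (S → ℝ) :=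
  P.map (LinearMap.funLeft ℝ ℝ (Subtype.val : S → X))

/-- The restriction map `p ↦ p|_S` from `P` onto the space of restrictions. -/
def toRestricted {X : Type*} (P : Submodule ℝ (X → ℝ)) (S : Set X) :
    P →ₗ[ℝ] restrictedSpace P S :=
  (LinearMap.funLeft ℝ ℝ (Subtype.val : S → X)).submoduleMap P

/-- The norm, with values in `[0,∞]`, of a linear functional on a space of functions on `S` that
carries the uniform norm on `S`. -/
def dualNorm {X : Type*} {S : Set X} {V : Submodule ℝ (S → ℝ)} (lam : V →ₗ[ℝ] ℝ) : ENNReal :=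
  ⨆ (f : V) (_ : supNorm f.1 univ ≤ 1), ‖lam f‖ₑ

/-- The fill distance `max_{x ∈ Ω} dist (x, Ξ)`. -/
def fillDistance {X : Type*} [PseudoMetricSpace X] (Ξ Ω : Set X) : ℝ :=
  ⨆ x : Ω, Metric.infDist (x : X) Ξ

/-- The constant `((2 + sin θ) / (Γ₁ sin θ)) ^ D`. -/
def coneFactor (D Γ₁ θ : ℝ) : ℝ := ((2 + Real.sin θ) / (Γ₁ * Real.sin θ)) ^ D

/-- The constant `κ`, which describes the support radius. -/
def kappa (D K Γ₁ θ : ℝ) : ℝ :=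
  K * (2 : ℝ) ^ (2 * D) * coneFactor D Γ₁ θ * ((1 + Γ₁ * Real.sin θ) / (Γ₁ * Real.sin θ))

/-- The threshold `h₀ = ε r* / ((1 + ε) κ)`. -/
def thresholdFill (ε rstar κ : ℝ) : ℝ := ε * rstar / ((1 + ε) * κ)

end LocalReproduction

end

/-! The heart is a norming inequality. Put `ρ = κ * h / ε`, which lies below `r*`. For `x ∈ Ω` and
`p ∈ P`, some `ξ ∈ Ξ` within `ρ` of `x` satisfies `(1 - ε) * |p x| ≤ |p ξ|` (`exists_mul_abs_le`).
To see this, let `y` maximize `|p|` on `Ω ∩ closedBall x R` and pick `ξ` within `h` of `y`. The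
interior cone at `x` contains a metric ball of radius comparable to `R`, so iterated doubling bounds
`|p|` on `ball x ρ` by `C * |p y|`. The Markov inequality turns this into a gradient bound `K * C *
|p y| / ρ`, and integrating along a short path from `y` to `ξ` gives `|p y - p ξ| ≤ (K * C / κ) * ε
* |p y|`. This needs `R + h < ρ` and `K * C ≤ κ`. The choice `R = ρ / 2` works unless `κ < 2`; then
other radii are used.

The norming inequality makes sampling on `Ξ ∩ ball α (κ * h + ρ)` injective on restrictions to `ball
α (κ * h) ∩ Ω`, with inverse of norm at most `(1 - ε)⁻¹`. A functional therefore factors through the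
samples. Hahn–Banach extends it to all of `ℓ^∞` without increasing its norm, and the dual of
finite-dimensional `ℓ^∞` is `ℓ¹`, which gives the coefficients (`exists_sum_abs_le_of_norming`).
Parts 2 and 3 apply this to evaluation at `α` and to `∇p(α) v`, the latter bounded by growth and
Markov on `ball α (κ * h)`. -/

/-! ### Short paths and connectedness of metric balls -/

open MeasureTheory Filter Topology in
-- The distance is an infimum of lengths, and an initial arc is no longer than the whole path, so
-- the path cannot leave the ball of radius `l` about `y`. Near-minimal paths avoid any appeal to
-- completeness.
theorem exists_short_path {d : ℕ} {M : Type*} [MetricSpace M]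
    [ChartedSpace (EuclideanSpace ℝ (Fin d)) M]
    [RiemannianBundle (fun x : M => TangentSpace (𝓡 d) x)]
    [IsRiemannianManifold (𝓡 d) M] {y z : M} {l : ℝ} (hl : dist y z < l) :
    ∃ γ : ℝ → M, γ 0 = y ∧ γ 1 = z ∧ ContMDiffOn 𝓘(ℝ, ℝ) (𝓡 d) 1 γ (Icc 0 1) ∧
      pathELength (𝓡 d) γ 0 1 < ENNReal.ofReal l ∧ ∀ t ∈ Icc (0 : ℝ) 1, dist y (γ t) < l := by
  have hlt : riemannianEDist (𝓡 d) y z < ENNReal.ofReal l := by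
    rw [← IsRiemannianManifold.out, edist_dist]
    exact (ENNReal.ofReal_lt_ofReal_iff (dist_nonneg.trans_lt hl)).2 hl
  obtain ⟨γ, h0, h1, hγ, hlen⟩ := exists_lt_of_riemannianEDist_lt hlt
  refine ⟨γ, h0, h1, hγ, hlen, fun t ht => ?_⟩
  have h2 : edist y (γ t) < ENNReal.ofReal l := by
    rw [IsRiemannianManifold.out (I := 𝓡 d)]
    refine lt_of_le_of_lt (riemannianEDist_le_pathELength (γ := γ) (a := 0) (b := t)
      (hγ.mono (Icc_subset_Icc_right ht.2)) h0 rfl ht.1) (lt_of_le_of_lt ?_ hlen)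
    exact pathELength_mono le_rfl ht.2
  rw [edist_dist] at h2
  exact (ENNReal.ofReal_lt_ofReal_iff (dist_nonneg.trans_lt hl)).1 h2

theorem isPreconnected_ball_of_isRiemannianManifold (d : ℕ) {M : Type*} [MetricSpace M]
    [ChartedSpace (EuclideanSpace ℝ (Fin d)) M]
    [RiemannianBundle (fun x : M => TangentSpace (𝓡 d) x)]
    [IsRiemannianManifold (𝓡 d) M] (x : M) (r : ℝ) : IsPreconnected (Metric.ball x r) := by
  refine isPreconnected_of_forall x fun y hy => ?_
  rw [Metric.mem_ball, dist_comm] at hy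
  obtain ⟨γ, h0, h1, hγ, -, hd⟩ := exists_short_path (d := d) hy
  refine ⟨γ '' Icc 0 1, ?_, ⟨0, by simp, h0⟩, ⟨1, by simp, h1⟩,
    isPreconnected_Icc.image _ hγ.continuousOn⟩
  rintro _ ⟨t, ht, rfl⟩
  rw [Metric.mem_ball, dist_comm]
  exact hd t ht

namespace LocalReproduction

section Geometry

variable {d : ℕ} {M : Type*} [MetricSpace M] [ChartedSpace (EuclideanSpace ℝ (Fin d)) M]
  [RiemannianBundle (fun x : M => TangentSpace (𝓡 d) x)]

open MeasureTheory in
theorem enorm_sub_le_mul_pathELength {p : M → ℝ} (hp : ContMDiff (𝓡 d) 𝓘(ℝ, ℝ) 1 p)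
    {γ : ℝ → M} (hγ : ContMDiffOn 𝓘(ℝ, ℝ) (𝓡 d) 1 γ (Icc 0 1)) {G : NNReal}
    (hG : ∀ t ∈ Icc (0 : ℝ) 1, ‖covDeriv (d := d) p (γ t)‖₊ ≤ G) :
    ‖p (γ 1) - p (γ 0)‖ₑ ≤ G * pathELength (𝓡 d) γ 0 1 := by
  have D : ContDiffOn ℝ 1 (p ∘ γ) (Icc 0 1) :=
    contMDiffOn_iff_contDiffOn.mp (hp.comp_contMDiffOn hγ)
  refine (enorm_sub_le_lintegral_derivWithin_Icc_of_contDiffOn_Icc D zero_le_one).trans ?_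
  rw [pathELength_eq_lintegral_mfderivWithin_Icc, ← lintegral_const_mul' _ _ ENNReal.coe_ne_top]
  refine setLIntegral_mono' measurableSet_Icc fun t ht => ?_
  have hcomp : mfderivWithin 𝓘(ℝ, ℝ) 𝓘(ℝ, ℝ) (p ∘ γ) (Icc 0 1) t =
      (mfderiv (𝓡 d) 𝓘(ℝ, ℝ) p (γ t)).comp (mfderivWithin 𝓘(ℝ, ℝ) (𝓡 d) γ (Icc 0 1) t) := by
    refine mfderiv_comp_mfderivWithin (I' := 𝓡 d) t ((hp (γ t)).mdifferentiableAt one_ne_zero)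
      (hγ.mdifferentiableOn one_ne_zero t ht) ?_
    exact (uniqueDiffOn_Icc zero_lt_one t ht).uniqueMDiffWithinAt
  have hderiv : derivWithin (p ∘ γ) (Icc 0 1) t =
      covDeriv (d := d) p (γ t) (mfderivWithin 𝓘(ℝ, ℝ) (𝓡 d) γ (Icc 0 1) t 1) := by
    rw [← fderivWithin_derivWithin, ← mfderivWithin_eq_fderivWithin, hcomp]
    rfl
  rw [hderiv]
  refine (ContinuousLinearMap.le_opENorm _ _).trans ?_
  gcongr
  exact ENNReal.coe_le_coe.2 (hG t ht)

theorem abs_sub_le_of_covDeriv_le [IsRiemannianManifold (𝓡 d) M] {p : M → ℝ}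
    (hp : ContMDiff (𝓡 d) 𝓘(ℝ, ℝ) 1 p) {x y z : M} {r G : ℝ} (hG0 : 0 ≤ G)
    (hG : ∀ m ∈ Metric.ball x r, ‖covDeriv (d := d) p m‖ ≤ G)
    (hr : dist x y + dist y z < r) : |p y - p z| ≤ G * dist y z := by
  have key : ∀ l, dist y z < l → l < r - dist x y → |p y - p z| ≤ G * l := by
    intro l hl hlr
    obtain ⟨γ, h0, h1, hγ, hlen, hd⟩ := exists_short_path (d := d) hl
    have h2 := enorm_sub_le_mul_pathELength hp hγ (G := G.toNNReal) fun t ht => by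
      refine NNReal.le_toNNReal_of_coe_le (hG _ ?_)
      have := dist_triangle x y (γ t)
      have := hd t ht
      rw [Metric.mem_ball, dist_comm]
      linarith
    have hl0 : 0 ≤ l := dist_nonneg.trans hl.le
    have h3 : ‖p z - p y‖ₑ ≤ ENNReal.ofReal (G * l) := by
      rw [ENNReal.ofReal_mul hG0, ← h0, ← h1]
      exact h2.trans (mul_le_mul_right hlen.le _)
    rw [← ofReal_norm, ENNReal.ofReal_le_ofReal_iff (by positivity)] at h3
    rwa [abs_sub_comm]
  have hlt : dist y z < r - dist x y := by linarith
  -- The bound holds for every admissible length `l > dist y z`; let `l` decrease to `dist y z`.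
  have hcl : dist y z ∈ closure (Ioo (dist y z) (r - dist x y)) := by
    rw [closure_Ioo hlt.ne]; exact ⟨le_rfl, hlt.le⟩
  exact closure_minimal (t := {l | |p y - p z| ≤ G * l}) (fun l hl => key l hl.1 hl.2)
    (isClosed_le continuous_const (continuous_const.mul continuous_id)) hcl

/-! ### The exponential map and metric balls inside cones -/

/-- Local minimality controls short arcs, and the triangle inequality propagates the bound along
`[0,1]` by continuous induction. -/
theorem IsGeodesicFrom.dist_le {γ : ℝ → M} {x : M} {v : TangentSpace (𝓡 d) x}
    (hγ : IsGeodesicFrom γ x v) {t : ℝ} (ht : t ∈ Icc (0 : ℝ) 1) : dist x (γ t) ≤ ‖v‖ * t := by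
  have hcont : ContinuousOn γ (Icc 0 1) := hγ.smooth.continuousOn
  have hsub : Icc (0 : ℝ) 1 ⊆ {t | dist x (γ t) ≤ ‖v‖ * t} := by
    refine IsClosed.Icc_subset_of_forall_mem_nhdsWithin (a := 0) (b := 1) ?_ ?_ ?_
    · rw [inter_comm]
      exact isClosed_Icc.isClosed_le ((continuous_const.dist continuous_id).comp_continuousOn hcont)
        (continuous_const.mul continuous_id).continuousOn
    · simp [hγ.start]
    · rintro t ⟨ht, ht1⟩
      obtain ⟨δ, hδ, h⟩ := hγ.minimizing t (Ico_subset_Icc_self ht1)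
      have hmem : Ioo t (min 1 (t + δ)) ∈ nhdsWithin t (Ioi t) :=
        Ioo_mem_nhdsGT (lt_min ht1.2 (by linarith))
      filter_upwards [hmem] with s hs
      have h1 := hs.2.trans_le (min_le_left _ _)
      have h2 := hs.2.trans_le (min_le_right _ _)
      have h3 := h t (Ico_subset_Icc_self ht1) s ⟨ht1.1.trans hs.1.le, h1.le⟩ (by simpa)
        (by rw [abs_of_pos (sub_pos.2 hs.1)]; linarith)
      rw [abs_sub_comm, abs_of_pos (sub_pos.2 hs.1)] at h3
      have h4 := dist_triangle x (γ t) (γ s)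
      simp only [mem_ofPred_eq] at ht ⊢
      nlinarith
  exact hsub ht

theorem dist_riemannianExp_le (x : M) (v : TangentSpace (𝓡 d) x) :
    dist x (riemannianExp x v) ≤ ‖v‖ := by
  unfold riemannianExp
  split_ifs with hv
  · simpa using hv.choose_spec.dist_le (t := 1) (by simp)
  · simp

theorem closedBall_subset_tangentCone {z : M} {v : TangentSpace (𝓡 d) z} (hv : ‖v‖ = 1)
    {θ t R : ℝ} (ht : 0 < t) (hθ : 0 < θ) (hθ' : θ < Real.pi / 2)
    (hR : t * (1 + Real.sin θ) ≤ R) :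
    Metric.closedBall (t • v) (t * Real.sin θ) ⊆ tangentCone R θ v := by
  intro u hu
  rw [Metric.mem_closedBall, dist_eq_norm] at hu
  have hs : 0 < Real.sin θ := Real.sin_pos_of_pos_of_lt_pi hθ (by linarith [Real.pi_pos])
  have hsq : ‖u - t • v‖ ^ 2 = ‖u‖ ^ 2 - 2 * (t * inner ℝ v u) + t ^ 2 := by
    rw [norm_sub_sq_real, real_inner_smul_right, norm_smul, hv, real_inner_comm]
    simp
  have hsc := Real.sin_sq_add_cos_sq θ
  refine ⟨?_, ?_⟩
  · have h1 := norm_sub_le (u - t • v) (-(t • v))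
    rw [sub_neg_eq_add, sub_add_cancel, norm_neg, norm_smul, hv, Real.norm_of_nonneg ht.le] at h1
    linarith
  · have h2 : ‖u - t • v‖ ^ 2 ≤ (t * Real.sin θ) ^ 2 := by gcongr
    -- Combined with `h2`, this gives `2t⟨v,u⟩ ≥ ‖u‖² + t² cos² θ ≥ 2t ‖u‖ cos θ`.
    have h3 := sq_nonneg (‖u‖ - t * Real.cos θ)
    refine le_of_mul_le_mul_left ?_ ht
    nlinarith

/-- The image of the tangent ball is open, and the lower metric bound keeps the image of its
boundary sphere at distance at least `Γ₁ * s` from the centre. The metric ball is connected, so it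
cannot leave the image. -/
theorem ball_subset_image_riemannianExp [IsRiemannianManifold (𝓡 d) M] {Ω : Set M}
    {r Γ₁ Γ₂ : ℝ} (hr : IsDiffeoRadius d Ω r) (hΓ : MetricEquivalence d Ω r Γ₁ Γ₂)
    {z : M} (hz : z ∈ Ω) {w : TangentSpace (𝓡 d) z} {s : ℝ} (hs : 0 < s)
    (hw : Metric.closedBall w s ⊆ Metric.ball 0 r) :
    Metric.ball (riemannianExp z w) (Γ₁ * s) ⊆ riemannianExp z '' Metric.ball w s := by
  have hD := hr.localDiffeo z hz
  have hwb : w ∈ Metric.ball (0 : TangentSpace (𝓡 d) z) r := hw (Metric.mem_closedBall_self hs.le)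
  have hopen : IsOpen (riemannianExp z '' Metric.ball w s) := by
    rw [isOpen_iff_mem_nhds]
    rintro _ ⟨u, hu, rfl⟩
    rw [← hD.isLocalHomeomorphOn.map_nhds_eq (hw (Metric.ball_subset_closedBall hu))]
    exact Filter.image_mem_map (Metric.isOpen_ball.mem_nhds hu)
  refine (isPreconnected_ball_of_isRiemannianManifold d _ _).subset_of_closure_inter_subset hopen
    ⟨riemannianExp z w, Metric.mem_ball_self (mul_pos hΓ.pos hs), w, Metric.mem_ball_self hs, rfl⟩ ?_
  have hcomp : IsCompact (riemannianExp z '' Metric.closedBall w s) := by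
    have : FiniteDimensional ℝ (TangentSpace (𝓡 d) z) :=
      inferInstanceAs (FiniteDimensional ℝ (EuclideanSpace ℝ (Fin d)))
    have := FiniteDimensional.proper_real (TangentSpace (𝓡 d) z)
    exact (isCompact_closedBall w s).image_of_continuousOn (hD.contMDiffOn.continuousOn.mono hw)
  rintro m ⟨hm, hmb⟩
  obtain ⟨u, hu, rfl⟩ := closure_minimal (image_mono Metric.ball_subset_closedBall)
    hcomp.isClosed hm
  refine ⟨u, ?_, rfl⟩
  have h1 := (hΓ.lower z hz u (hw hu) w hwb).trans_lt hmb
  rw [Metric.mem_ball, dist_eq_norm]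
  exact lt_of_mul_lt_mul_left h1 hΓ.pos.le

theorem InteriorConeDomain.sin_pos {Ω : Set M} {rf θ : ℝ}
    (hΩ : InteriorConeDomain d Ω rf θ) : 0 < Real.sin θ :=
  Real.sin_pos_of_pos_of_lt_pi hΩ.aperture_pos (by linarith [Real.pi_pos, hΩ.aperture_lt])

theorem InteriorConeDomain.exists_ball_subset [IsRiemannianManifold (𝓡 d) M] {Ω : Set M}
    {rf θ r Γ₁ Γ₂ : ℝ} (hΩ : InteriorConeDomain d Ω rf θ)
    (hr : IsDiffeoRadius d Ω r) (hΓ : MetricEquivalence d Ω r Γ₁ Γ₂)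
    {z : M} (hz : z ∈ Ω) {R : ℝ} (hR : 0 < R) (hRf : R ≤ rf) (hRr : R < r) :
    ∃ w, dist z w ≤ R / (1 + Real.sin θ) ∧
      Metric.ball w (Γ₁ * (R / (1 + Real.sin θ) * Real.sin θ)) ⊆ Ω ∩ Metric.closedBall z R := by
  obtain ⟨v, hv, hcone⟩ := hΩ.cone z hz
  have hs := hΩ.sin_pos
  have ht : 0 < R / (1 + Real.sin θ) := by positivity
  have hsub := closedBall_subset_tangentCone hv ht hΩ.aperture_pos hΩ.aperture_lt (R := R)
    (div_mul_cancel₀ _ (by positivity)).le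
  refine ⟨riemannianExp z ((R / (1 + Real.sin θ)) • v), ?_, ?_⟩
  · refine (dist_riemannianExp_le _ _).trans ?_
    rw [norm_smul, hv, Real.norm_of_nonneg ht.le, mul_one]
  · refine (ball_subset_image_riemannianExp hr hΓ hz (by positivity) ?_).trans ?_
    · intro u hu
      rw [Metric.mem_ball, dist_zero_right]
      exact (hsub hu).1.trans_lt hRr
    · rintro _ ⟨u, hu, rfl⟩
      have hu' := hsub (Metric.ball_subset_closedBall hu)
      refine ⟨hcone ⟨u, ⟨hu'.1.trans hRf, hu'.2⟩, rfl⟩, ?_⟩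
      rw [Metric.mem_closedBall, dist_comm]
      exact (dist_riemannianExp_le _ _).trans hu'.1

/-- `Exp_z` does not increase distances from the centre. The bound makes the ball found in a cone no
larger than the ball on which growth is estimated. -/
theorem MetricEquivalence.lower_constant_le_one {Ω : Set M}
    {rf θ r Γ₁ Γ₂ : ℝ} (hΩ : InteriorConeDomain d Ω rf θ) (hr : 0 < r)
    (hΓ : MetricEquivalence d Ω r Γ₁ Γ₂) {z : M} (hz : z ∈ Ω) : Γ₁ ≤ 1 := by
  obtain ⟨v, hv, -⟩ := hΩ.cone z hz
  have hn : ‖(r / 2) • v‖ = r / 2 := by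
    rw [norm_smul, hv, Real.norm_of_nonneg (by positivity), mul_one]
  have h0 : riemannianExp z (0 : TangentSpace (𝓡 d) z) = z := by
    have := dist_riemannianExp_le z (0 : TangentSpace (𝓡 d) z)
    rw [norm_zero] at this
    exact (dist_le_zero.1 this).symm
  have h1 := hΓ.lower z hz ((r / 2) • v) (by rw [Metric.mem_ball, dist_zero_right, hn]; linarith) 0
    (Metric.mem_ball_self hr)
  rw [sub_zero, hn, h0, dist_comm] at h1
  have h2 := h1.trans (dist_riemannianExp_le z ((r / 2) • v))
  rw [hn] at h2
  nlinarith

/-- The axis of a cone maps injectively into `Ω`. This makes the fill distance of a finite set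
positive. -/
theorem InteriorConeDomain.infinite {Ω : Set M} {rf θ r : ℝ} (hΩ : InteriorConeDomain d Ω rf θ)
    (hr : IsDiffeoRadius d Ω r) {z : M} (hz : z ∈ Ω) : Ω.Infinite := by
  obtain ⟨v, hv, hcone⟩ := hΩ.cone z hz
  have hr0 := hr.pos
  have hf0 := hΩ.radius_pos
  have hn : ∀ t ∈ Ioo 0 (min rf r), ‖t • v‖ = t := fun t ht => by
    rw [norm_smul, hv, Real.norm_of_nonneg ht.1.le, mul_one]
  have hinj : InjOn (fun t : ℝ => riemannianExp z (t • v)) (Ioo 0 (min rf r)) := by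
    intro t ht t' ht' h
    have hb : ∀ t ∈ Ioo 0 (min rf r), t • v ∈ Metric.ball (0 : TangentSpace (𝓡 d) z) r :=
      fun t ht => by
        rw [Metric.mem_ball, dist_zero_right, hn t ht]
        exact ht.2.trans_le (min_le_right _ _)
    have := hr.injOn z hz (hb t ht) (hb t' ht') h
    rw [← hn t ht, this, hn t' ht']
  refine ((Ioo_infinite (lt_min hf0 hr0)).image hinj).mono ?_
  rintro _ ⟨t, ht, rfl⟩
  refine hcone ⟨t • v, ⟨?_, ?_⟩, rfl⟩
  · rw [hn t ht]; exact (ht.2.trans_le (min_le_left _ _)).le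
  · rw [hn t ht, real_inner_smul_right, real_inner_self_eq_norm_sq, hv]
    nlinarith [ht.1, Real.cos_le_one θ]

/-! ### Consequences of the doubling and Markov inequalities -/

theorem supNorm_le_ofReal_iff {X : Type*} {f : X → ℝ} {S : Set X} {B : ℝ} (hB : 0 ≤ B) :
    supNorm f S ≤ ENNReal.ofReal B ↔ ∀ x ∈ S, |f x| ≤ B := by
  simp only [supNorm, iSup_le_iff, ← ofReal_norm, ENNReal.ofReal_le_ofReal_iff hB,
    Real.norm_eq_abs]

namespace DoublingMarkovSpace

variable {P : Submodule ℝ (M → ℝ)} {D K rs : ℝ}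

theorem abs_le_of_doubling (hP : DoublingMarkovSpace d P D K rs) {p : M → ℝ} (hp : p ∈ P)
    {x : M} {r B : ℝ} (hr : 0 < r) (hrs : r < rs) (hB : 0 ≤ B)
    (h : ∀ m ∈ Metric.ball x r, |p m| ≤ B) : ∀ m ∈ Metric.ball x (2 * r), |p m| ≤ 2 ^ D * B := by
  rw [← supNorm_le_ofReal_iff (by positivity), ENNReal.ofReal_mul (by positivity)]
  refine (hP.doubling p hp r hr hrs x).trans ?_
  gcongr
  exact (supNorm_le_ofReal_iff hB).2 h

theorem norm_covDeriv_le (hP : DoublingMarkovSpace d P D K rs) {p : M → ℝ} (hp : p ∈ P)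
    (hK : 0 ≤ K) {x : M} {r B : ℝ} (hr : 0 < r) (hrs : r < rs) (hB : 0 ≤ B)
    (h : ∀ m ∈ Metric.ball x r, |p m| ≤ B) :
    ∀ m ∈ Metric.ball x r, ‖covDeriv (d := d) p m‖ ≤ K / r * B := by
  have h1 : ⨆ m ∈ Metric.ball x r, ‖covDeriv (d := d) p m‖ₑ ≤ ENNReal.ofReal (K / r * B) := by
    rw [ENNReal.ofReal_mul (by positivity)]
    refine (hP.markov p hp r hr hrs x).trans ?_
    gcongr
    exact (supNorm_le_ofReal_iff hB).2 h
  intro m hm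
  have h2 := (le_iSup₂ (f := fun m (_ : m ∈ Metric.ball x r) => ‖covDeriv (d := d) p m‖ₑ)
    m hm).trans h1
  rwa [← ofReal_norm, ENNReal.ofReal_le_ofReal_iff (by positivity)] at h2

/-- For `D < 0`, doubling contracts the bound for `p` on one fixed ball, and iteration forces `p x =
0`. A negative exponent is thus trivial, and otherwise powers with exponent `D` are monotone. -/
theorem exponent_nonneg (hP : DoublingMarkovSpace d P D K rs) {p : M → ℝ} (hp : p ∈ P)
    {x : M} (hx : p x ≠ 0) : 0 ≤ D := by
  by_contra! hD
  have hcont : Continuous p := (hP.contMDiff p hp).continuous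
  have hpos : 0 < |p x| := abs_pos.2 hx
  obtain ⟨r, hr, hball⟩ := Metric.continuousAt_iff.1 (hcont.abs.continuousAt (x := x)) 1 one_pos
  set r' := min r (rs / 2) with hr'def
  have hrs := hP.radius_pos
  have hr' : 0 < r' := lt_min hr (by linarith)
  have hr's : r' < rs := (min_le_right _ _).trans_lt (by linarith)
  have hn : ∀ n : ℕ, ∀ m ∈ Metric.ball x r', |p m| ≤ ((2 : ℝ) ^ D) ^ n * (|p x| + 1) := by
    intro n
    induction n with
    | zero =>
      intro m hm
      have := hball (hm.trans_le (min_le_left _ _))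
      rw [Real.dist_eq, abs_lt] at this
      rw [pow_zero]
      linarith [this.2]
    | succ n ih =>
      intro m hm
      rw [pow_succ', mul_assoc]
      exact hP.abs_le_of_doubling hp hr' hr's (by positivity) ih m
        (Metric.ball_subset_ball (by linarith) hm)
  have hlim : Filter.Tendsto (fun n : ℕ => ((2 : ℝ) ^ D) ^ n * (|p x| + 1)) Filter.atTop
      (nhds (0 * (|p x| + 1))) :=
    (tendsto_pow_atTop_nhds_zero_of_lt_one (by positivity)
      (Real.rpow_lt_one_of_one_lt_of_neg one_lt_two hD)).mul_const _
  have := ge_of_tendsto' hlim fun n => hn n x (Metric.mem_ball_self hr')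
  linarith

/-- With `2 ^ n ≤ L / r < 2 ^ (n + 1)`, double `n + 1` times starting from `L / 2 ^ (n + 1) ≤ r`.
The last radius fed to doubling is `L / 2 < rs`, and the one surplus doubling costs the extra `2 ^
D`. -/
theorem abs_le_of_ball (hP : DoublingMarkovSpace d P D K rs) {p : M → ℝ} (hp : p ∈ P)
    (hD : 0 ≤ D) {w : M} {r L B : ℝ} (hr : 0 < r) (hrL : r ≤ L) (hL : L < 2 * rs) (hB : 0 ≤ B)
    (h : ∀ m ∈ Metric.ball w r, |p m| ≤ B) :
    ∀ m ∈ Metric.ball w L, |p m| ≤ 2 ^ D * (L / r) ^ D * B := by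
  have hL0 : 0 < L := hr.trans_le hrL
  have h1 : 1 ≤ L / r := (one_le_div hr).2 hrL
  obtain ⟨n, hn1, hn2⟩ := exists_nat_pow_near h1 (one_lt_two (α := ℝ))
  have hn0 : (0 : ℝ) < 2 ^ (n + 1) := by positivity
  have hle : L / 2 ^ (n + 1) ≤ r := by
    rw [div_le_iff₀ hn0]; rw [div_lt_iff₀ hr] at hn2; linarith
  have key : ∀ j ≤ n + 1, ∀ m ∈ Metric.ball w (2 ^ j * (L / 2 ^ (n + 1))),
      |p m| ≤ ((2 : ℝ) ^ D) ^ j * B := by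
    intro j
    induction j with
    | zero =>
      intro _ m hm
      simpa using h m (Metric.ball_subset_ball (by simpa using hle) hm)
    | succ j ih =>
      intro hj m hm
      have hlt : 2 ^ j * (L / 2 ^ (n + 1)) < rs := by
        have h2 : (2 : ℝ) ^ j ≤ 2 ^ n := pow_le_pow_right₀ one_le_two (by omega)
        have h3 : (2 : ℝ) ^ n * (L / 2 ^ (n + 1)) = L / 2 := by field_simp; ring
        have h4 : 2 ^ j * (L / 2 ^ (n + 1)) ≤ 2 ^ n * (L / 2 ^ (n + 1)) := by gcongr
        linarith
      rw [pow_succ', mul_assoc]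
      refine hP.abs_le_of_doubling hp (by positivity) hlt (by positivity) (ih (by omega)) m ?_
      rwa [← mul_assoc, ← pow_succ']
  intro m hm
  refine (key (n + 1) le_rfl m ?_).trans ?_
  · rwa [mul_div_cancel₀ _ hn0.ne']
  · gcongr
    rw [← Real.rpow_natCast, ← Real.rpow_mul (by norm_num), mul_comm, Real.rpow_mul (by norm_num),
      Real.rpow_natCast, pow_succ', Real.mul_rpow (by norm_num) (by positivity)]
    gcongr

end DoublingMarkovSpace

end Geometry

/-! ### Growth from the domain to balls, and the local norming step -/

section Norming

variable {d : ℕ} {M : Type*} [MetricSpace M] [ChartedSpace (EuclideanSpace ℝ (Fin d)) M]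
  [RiemannianBundle (fun x : M => TangentSpace (𝓡 d) x)]
  [IsRiemannianManifold (𝓡 d) M] {P : Submodule ℝ (M → ℝ)} {D K rs : ℝ} {Ω : Set M}
  {rf θ r Γ₁ Γ₂ : ℝ}

theorem abs_le_of_abs_le_inter_closedBall (hP : DoublingMarkovSpace d P D K rs)
    (hΩ : InteriorConeDomain d Ω rf θ) (hr : IsDiffeoRadius d Ω r)
    (hΓ : MetricEquivalence d Ω r Γ₁ Γ₂) {p : M → ℝ} (hp : p ∈ P) {x : M} (hx : x ∈ Ω)
    {R ρ B : ℝ} (hR : 0 < R) (hRρ : R ≤ ρ) (hRf : R ≤ rf) (hRr : R < r) (hρ : ρ < rs)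
    (hB : ∀ m ∈ Ω ∩ Metric.closedBall x R, |p m| ≤ B) :
    ∀ m ∈ Metric.ball x ρ,
      |p m| ≤ 2 ^ D * ((ρ * (1 + Real.sin θ) / R + 1) / (Γ₁ * Real.sin θ)) ^ D * B := by
  have hs := hΩ.sin_pos
  have hΓ0 := hΓ.pos
  have hρ0 : 0 < ρ := hR.trans_le hRρ
  have hB0 : 0 ≤ B := (abs_nonneg _).trans (hB x ⟨hx, Metric.mem_closedBall_self hR.le⟩)
  rcases le_or_gt 0 D with hD | hD
  swap
  · intro m _
    have h0 : p m = 0 := by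
      by_contra h
      exact hD.not_ge (hP.exponent_nonneg hp h)
    rw [h0, abs_zero]
    positivity
  obtain ⟨w, hw, hsub⟩ := hΩ.exists_ball_subset hr hΓ hx hR hRf hRr
  have hΓ1 := hΓ.lower_constant_le_one hΩ hr.pos hx
  have ht : 0 < R / (1 + Real.sin θ) := by positivity
  have htR : R / (1 + Real.sin θ) ≤ R := div_le_self hR.le (by linarith)
  have hg : Γ₁ * Real.sin θ ≤ 1 := mul_le_one₀ hΓ1 hs.le (Real.sin_le_one θ)
  have hle : Γ₁ * (R / (1 + Real.sin θ) * Real.sin θ) ≤ ρ + R / (1 + Real.sin θ) := by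
    calc Γ₁ * (R / (1 + Real.sin θ) * Real.sin θ)
        = R / (1 + Real.sin θ) * (Γ₁ * Real.sin θ) := by ring
      _ ≤ R / (1 + Real.sin θ) * 1 := by gcongr
      _ ≤ _ := by linarith
  -- The ball about `w` with this radius contains `ball x ρ`; its ratio to the radius of the ball
  -- inside the cone is the base of the power in the claim.
  have key := hP.abs_le_of_ball hp hD (w := w) (L := ρ + R / (1 + Real.sin θ)) (by positivity) hle
    (by linarith) hB0 fun m hm => hB m (hsub hm)
  intro m hm
  refine (key m ?_).trans (le_of_eq ?_)
  · rw [Metric.mem_ball] at hm ⊢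
    linarith [dist_triangle m x w]
  · congr 3
    field_simp

theorem abs_le_of_abs_le_inter_closedBall_half (hP : DoublingMarkovSpace d P D K rs)
    (hΩ : InteriorConeDomain d Ω rf θ) (hr : IsDiffeoRadius d Ω r)
    (hΓ : MetricEquivalence d Ω r Γ₁ Γ₂) {p : M → ℝ} (hp : p ∈ P) {x : M} (hx : x ∈ Ω)
    {ρ B : ℝ} (hρ0 : 0 < ρ) (hρf : ρ ≤ rf) (hρr : ρ ≤ r) (hρ : ρ < rs)
    (hB : ∀ m ∈ Ω ∩ Metric.closedBall x (ρ / 2), |p m| ≤ B) :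
    ∀ m ∈ Metric.ball x ρ, |p m| ≤ 2 ^ (2 * D) * coneFactor D Γ₁ θ * B := by
  have hs := hΩ.sin_pos
  have hΓ0 := hΓ.pos
  have hB0 : 0 ≤ B := (abs_nonneg _).trans
    (hB x ⟨hx, Metric.mem_closedBall_self (by positivity)⟩)
  intro m hm
  by_cases h0 : p m = 0
  · rw [h0, abs_zero, coneFactor]
    positivity
  have hD := hP.exponent_nonneg hp h0
  refine (abs_le_of_abs_le_inter_closedBall hP hΩ hr hΓ hp hx (half_pos hρ0) (by linarith)
    (by linarith) (by linarith) hρ hB m hm).trans ?_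
  have hsplit : 2 ^ (2 * D) * coneFactor D Γ₁ θ =
      2 ^ D * (2 * ((2 + Real.sin θ) / (Γ₁ * Real.sin θ))) ^ D := by
    rw [coneFactor, two_mul, Real.rpow_add two_pos, Real.mul_rpow two_pos.le (by positivity)]
    ring
  rw [hsplit]
  gcongr
  rw [← mul_div_assoc]
  gcongr
  rw [show ρ * (1 + Real.sin θ) / (ρ / 2) = 2 * (1 + Real.sin θ) by field_simp]
  linarith

theorem exists_mul_abs_le_of_growth (hP : DoublingMarkovSpace d P D K rs) (hΩ : IsCompact Ω)
    {Ξ : Set M} {h : ℝ} (hh : ∀ y ∈ Ω, ∃ ξ ∈ Ξ, dist y ξ ≤ h)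
    {p : M → ℝ} (hp : p ∈ P) {x : M} (hx : x ∈ Ω) (hK : 0 ≤ K)
    {R ρ C ε κ : ℝ} (hR : 0 ≤ R) (hκ : 0 < κ) (hε : 0 < ε) (hρ0 : 0 < ρ) (hρ : ρ < rs)
    (hRh : R + h < ρ) (hhρ : h = ε * ρ / κ) (hKC : K * C ≤ κ) (hC0 : 0 ≤ C)
    (hC : ∀ B, (∀ m ∈ Ω ∩ Metric.closedBall x R, |p m| ≤ B) →
      ∀ m ∈ Metric.ball x ρ, |p m| ≤ C * B) :
    ∃ ξ ∈ Ξ, dist x ξ < ρ ∧ (1 - ε) * |p x| ≤ |p ξ| := by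
  have hC1 := hP.contMDiff p hp
  have hxmem : x ∈ Ω ∩ Metric.closedBall x R := ⟨hx, Metric.mem_closedBall_self hR⟩
  obtain ⟨y, hy, hmax⟩ := (hΩ.inter_right Metric.isClosed_closedBall).exists_isMaxOn ⟨x, hxmem⟩
    hC1.continuous.abs.continuousOn
  obtain ⟨ξ, hξ, hd⟩ := hh y hy.1
  have hyR : dist x y ≤ R := by rw [dist_comm]; exact hy.2
  refine ⟨ξ, hξ, by linarith [dist_triangle x y ξ], ?_⟩
  have hbd := hC |p y| fun m hm => hmax hm
  have hgrad := hP.norm_covDeriv_le hp hK hρ0 hρ (by positivity) hbd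
  have hmv := abs_sub_le_of_covDeriv_le hC1 (y := y) (z := ξ) (by positivity) hgrad (by linarith)
  have hxy : |p x| ≤ |p y| := hmax hxmem
  have hest : K / ρ * (C * |p y|) * dist y ξ ≤ ε * |p y| := by
    calc K / ρ * (C * |p y|) * dist y ξ ≤ K / ρ * (C * |p y|) * h := by gcongr
      _ = (K * C) * (ε / κ * |p y|) := by rw [hhρ]; field_simp
      _ ≤ κ * (ε / κ * |p y|) := by gcongr
      _ = ε * |p y| := by field_simp
  have h1 := abs_sub_abs_le_abs_sub (p y) (p ξ)
  have h2 : (1 - ε) * |p y| ≤ |p ξ| := by linarith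
  rcases le_or_gt ε 1 with h3 | h3
  · exact (mul_le_mul_of_nonneg_left hxy (by linarith)).trans h2
  · exact (mul_nonpos_of_nonpos_of_nonneg (by linarith) (abs_nonneg _)).trans (abs_nonneg _)

/-- A small Markov constant bounds the growth of a function from the centre of a ball. -/
theorem abs_le_of_markov_lt_one (hP : DoublingMarkovSpace d P D K rs)
    {p : M → ℝ} (hp : p ∈ P) {x : M} (hK : 0 ≤ K) (hK1 : K < 1) {ρ B : ℝ} (hρ0 : 0 < ρ)
    (hρ : ρ < rs) (hB : ∀ m ∈ Metric.ball x ρ, |p m| ≤ B) :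
    ∀ m ∈ Metric.ball x ρ, |p m| ≤ (1 - K)⁻¹ * |p x| := by
  set S := sSup ((fun m => |p m|) '' Metric.ball x ρ)
  have hne : ((fun m => |p m|) '' Metric.ball x ρ).Nonempty :=
    ⟨_, mem_image_of_mem _ (Metric.mem_ball_self hρ0)⟩
  have hle : ∀ m ∈ Metric.ball x ρ, |p m| ≤ S := fun m hm =>
    le_csSup ⟨B, by rintro _ ⟨m, hm, rfl⟩; exact hB m hm⟩ (mem_image_of_mem _ hm)
  have hS0 : 0 ≤ S := (abs_nonneg _).trans (hle x (Metric.mem_ball_self hρ0))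
  have hgrad := hP.norm_covDeriv_le hp hK hρ0 hρ hS0 hle
  -- Mean value bound along paths from the centre. The a priori bound `B` serves only to make `S`
  -- finite, so that `K * S` can be absorbed.
  have hS : S ≤ |p x| + K * S := by
    refine csSup_le hne ?_
    rintro _ ⟨m, hm, rfl⟩
    have hm' : dist x m < ρ := by rw [dist_comm]; exact hm
    have hmv := abs_sub_le_of_covDeriv_le (hP.contMDiff p hp) (y := x) (z := m) (by positivity)
      hgrad (by rwa [dist_self, zero_add])
    have h1 : K / ρ * S * dist x m ≤ K / ρ * S * ρ := by gcongr
    have h2 : K / ρ * S * ρ = K * S := by field_simp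
    have h3 := abs_sub_abs_le_abs_sub (p m) (p x)
    rw [abs_sub_comm] at h3
    change |p m| ≤ _
    linarith
  intro m hm
  refine (hle m hm).trans ?_
  rw [inv_mul_eq_div, le_div_iff₀ (by linarith)]
  linarith

end Norming

/-- Settles `R = (1 - 1/κ) * ρ` in the norming step. The hypotheses force `D` to be small relative
to `κ - 1`: `κ ≥ 2K * 12 ^ D` and `K > κ / (1 + κ)` give `κ - 1 > 4D`. The loss `(1 / (κ - 1)) ^ D`
from the larger radius is then at most `2`, and the factor `(1 + g) / g ≥ 2` in `κ` absorbs it. -/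
theorem growth_constant_le {D K g s κ : ℝ} (hD : 0 ≤ D) (hK : 0 < K) (hg0 : 0 < g)
    (hgs : g ≤ s) (hs : s ≤ 1)
    (hκ : κ = K * (2 : ℝ) ^ (2 * D) * ((2 + s) / g) ^ D * ((1 + g) / g))
    (hκ1 : 1 ≤ κ) (hκ2 : κ < 2) (hKκ : κ < K * (1 + κ)) :
    1 < κ ∧ K * (2 ^ D * (((1 + s) / (1 - 1 / κ) + 1) / g) ^ D) ≤ κ := by
  have hF : (3 : ℝ) ^ D ≤ ((2 + s) / g) ^ D := by
    gcongr
    rw [le_div_iff₀ hg0]; linarith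
  have hG : 2 ≤ (1 + g) / g := by rw [le_div_iff₀ hg0]; linarith
  have h12 : (12 : ℝ) ^ D = 2 ^ (2 * D) * 3 ^ D := by
    rw [Real.rpow_mul two_pos.le, ← Real.mul_rpow (by positivity) (by norm_num)]
    norm_num
  have hlow : K * 12 ^ D * 2 ≤ κ := by
    rw [hκ, h12, ← mul_assoc K]
    have : 0 ≤ (2 + s) / g := div_nonneg (by linarith) hg0.le
    gcongr
  have hκ12 : 2 * (12 : ℝ) ^ D < 1 + κ := by
    have h1 : (2 * (12 : ℝ) ^ D) * κ < (2 * (12 : ℝ) ^ D) * (K * (1 + κ)) := by gcongr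
    have h2 : K * 12 ^ D * 2 * (1 + κ) ≤ κ * (1 + κ) := by gcongr
    nlinarith
  have hexp : 1 + 2 * D ≤ (12 : ℝ) ^ D := by
    have hlog : 2 ≤ Real.log 12 := by
      rw [Real.le_log_iff_exp_le (by norm_num), show (2 : ℝ) = 1 + 1 by norm_num, Real.exp_add]
      nlinarith [Real.exp_one_lt_d9, Real.exp_pos 1]
    rw [Real.rpow_def_of_pos (by norm_num)]
    have := Real.add_one_le_exp (Real.log 12 * D)
    nlinarith
  have hu : 4 * D < κ - 1 := by linarith
  have hu0 : 0 < κ - 1 := by linarith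
  refine ⟨by linarith, ?_⟩
  have hpow : (1 / (κ - 1)) ^ D ≤ 2 := by
    rw [Real.rpow_def_of_pos (by positivity), ← Real.le_log_iff_exp_le two_pos]
    have h1 := Real.log_le_sub_one_of_pos (x := 1 / (κ - 1)) (by positivity)
    have h2 : Real.log (1 / (κ - 1)) * D ≤ 1 / (κ - 1) * D := by gcongr; linarith
    have h3 : 1 / (κ - 1) * D ≤ 1 / 4 := by
      rw [one_div_mul_eq_div, div_le_iff₀ hu0]; linarith
    linarith [Real.log_two_gt_d9]
  have ha : 1 - 1 / κ = (κ - 1) / κ := by field_simp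
  have hbase : ((1 + s) / (1 - 1 / κ) + 1) / g ≤ 2 * (1 / (κ - 1)) * ((2 + s) / g) := by
    rw [ha, ← mul_div_assoc]
    gcongr
    rw [div_div_eq_mul_div, div_add_one hu0.ne', ← mul_div_assoc, mul_one, div_mul_eq_mul_div]
    gcongr
    nlinarith
  have hpos : 0 ≤ ((1 + s) / (1 - 1 / κ) + 1) / g := by
    rw [ha]
    have : 0 ≤ s := hg0.le.trans hgs
    positivity
  have hq : 0 ≤ (2 + s) / g := div_nonneg (by linarith) hg0.le
  calc K * (2 ^ D * (((1 + s) / (1 - 1 / κ) + 1) / g) ^ D)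
      ≤ K * (2 ^ D * (2 * (1 / (κ - 1)) * ((2 + s) / g)) ^ D) := by gcongr
    _ = K * (2 ^ (2 * D)) * ((2 + s) / g) ^ D * (1 / (κ - 1)) ^ D := by
        rw [Real.mul_rpow (by positivity) hq, Real.mul_rpow two_pos.le (by positivity),
          two_mul D, Real.rpow_add two_pos]
        ring
    _ ≤ K * (2 ^ (2 * D)) * ((2 + s) / g) ^ D * ((1 + g) / g) := by
        gcongr
        exact hpow.trans hG
    _ = κ := hκ.symm

/-! ### Representation of functionals by point evaluations -/

theorem sum_abs_apply_single_le_norm {ι : Type*} [Fintype ι] [DecidableEq ι]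
    (g : StrongDual ℝ (ι → ℝ)) : ∑ i, |g (Pi.single i 1)| ≤ ‖g‖ := by
  set s : ι → ℝ := fun i => SignType.sign (g (Pi.single i 1))
  have hs : ‖s‖ ≤ 1 := by
    rw [pi_norm_le_iff_of_nonneg zero_le_one]
    intro i
    rcases lt_trichotomy (g (Pi.single i 1)) 0 with h | h | h <;> simp [s, h]
  have h1 : g s = ∑ i, |g (Pi.single i 1)| := by
    conv_lhs => rw [pi_eq_sum_univ' s]
    rw [map_sum]
    refine Finset.sum_congr rfl fun i _ => ?_
    rw [map_smul, smul_eq_mul]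
    exact sign_mul_self _
  rw [← h1]
  exact (le_abs_self _).trans ((g.le_opNorm s).trans (mul_le_of_le_one_right (norm_nonneg _) hs))

/-- `L` factors through the samples on `Ξ ∩ U`; a norm-preserving extension to the whole sup-normed
sample space has coefficients whose `ℓ¹` norm is at most its operator norm. Vanishing on the kernel
is assumed apart from any bound, so the representation is available even without a finite `C`. -/
theorem exists_sum_abs_le_of_norming {X : Type*} {P : Submodule ℝ (X → ℝ)} (L : P →ₗ[ℝ] ℝ)
    (Ξ : Finset X) (U : Set X) (hL : ∀ p : P, (∀ ξ ∈ Ξ, ξ ∈ U → p.1 ξ = 0) → L p = 0) :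
    ∃ a : X → ℝ, Function.support a ⊆ (Ξ : Set X) ∩ U ∧
      (∀ p : P, ∑ ξ ∈ Ξ, a ξ * p.1 ξ = L p) ∧
      ∀ C, 0 ≤ C → (∀ p : P, ∃ ξ ∈ Ξ, ξ ∈ U ∧ |L p| ≤ C * |p.1 ξ|) → ∑ ξ ∈ Ξ, |a ξ| ≤ C := by
  classical
  set T := Ξ.filter (· ∈ U)
  set ev : P →ₗ[ℝ] (T → ℝ) := (LinearMap.funLeft ℝ ℝ (Subtype.val : T → X)).comp P.subtype
  have hev : ∀ p : P, ∀ ξ : T, ev p ξ = p.1 ξ := fun p ξ => rfl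
  have hker : LinearMap.ker ev ≤ LinearMap.ker L := by
    intro p hp
    refine hL p fun ξ hξ hU => ?_
    exact congrFun (LinearMap.mem_ker.1 hp) ⟨ξ, Finset.mem_filter.2 ⟨hξ, hU⟩⟩
  set f₀ : LinearMap.range ev →ₗ[ℝ] ℝ :=
    ((LinearMap.ker ev).liftQ L hker).comp ev.quotKerEquivRange.symm.toLinearMap
  have hf₀ : ∀ p : P, f₀ ⟨ev p, LinearMap.mem_range_self ev p⟩ = L p := by
    intro p
    have : ev.quotKerEquivRange.symm ⟨ev p, LinearMap.mem_range_self ev p⟩ =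
        (LinearMap.ker ev).mkQ p := ev.quotKerEquivRange_symm_apply_image p _
    simp only [f₀, LinearMap.comp_apply, LinearEquiv.coe_coe, this, Submodule.mkQ_apply,
      Submodule.liftQ_apply]
  obtain ⟨g, hg, hgn⟩ := exists_extension_norm_eq _ (LinearMap.toContinuousLinearMap f₀)
  set a : X → ℝ := fun x => if hx : x ∈ T then g (Pi.single ⟨x, hx⟩ 1) else 0
  have ha : ∀ ξ : T, a ξ = g (Pi.single ξ 1) := fun ξ => by simp [a]
  have ha0 : ∀ ξ ∉ T, a ξ = 0 := fun ξ hξ => by simp [a, hξ]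
  have hTΞ : T ⊆ Ξ := Finset.filter_subset _ _
  refine ⟨a, ?_, ?_, ?_⟩
  · intro x hx
    by_contra h
    refine hx (ha0 x fun hT => h ?_)
    exact Finset.mem_filter.1 hT
  · intro p
    rw [← Finset.sum_subset hTΞ fun ξ _ hξ => by rw [ha0 ξ hξ, zero_mul], ← Finset.sum_coe_sort]
    rw [← hf₀ p]
    have h1 := hg ⟨ev p, LinearMap.mem_range_self ev p⟩
    rw [LinearMap.coe_toContinuousLinearMap'] at h1
    rw [← h1]
    change _ = g (ev p)
    conv_rhs => rw [pi_eq_sum_univ' (ev p)]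
    rw [map_sum]
    refine Finset.sum_congr rfl fun ξ _ => ?_
    rw [map_smul, smul_eq_mul, ha, hev, mul_comm]
  · intro C hC hbd
    rw [← Finset.sum_subset hTΞ fun ξ _ hξ => by rw [ha0 ξ hξ, abs_zero], ← Finset.sum_coe_sort]
    simp only [ha]
    refine (sum_abs_apply_single_le_norm g).trans ?_
    rw [hgn]
    refine ContinuousLinearMap.opNorm_le_bound _ hC ?_
    rintro ⟨_, p, rfl⟩
    rw [LinearMap.coe_toContinuousLinearMap', hf₀, Real.norm_eq_abs]
    obtain ⟨ξ, hξ, hU, h⟩ := hbd p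
    refine h.trans ?_
    gcongr
    exact norm_le_pi_norm (ev p) ⟨ξ, Finset.mem_filter.2 ⟨hξ, hU⟩⟩

theorem abs_le_toReal_dualNorm_mul {X : Type*} {S : Set X} {V : Submodule ℝ (S → ℝ)}
    (lam : V →ₗ[ℝ] ℝ) (hlam : dualNorm lam ≠ ⊤) {f : V} {N : ℝ} (hf : ∀ x, |f.1 x| ≤ N)
    (hN : 0 ≤ N) : |lam f| ≤ (dualNorm lam).toReal * N := by
  rcases hN.eq_or_lt with rfl | hN
  · have : f = 0 := by
      ext x
      exact abs_nonpos_iff.1 (hf x)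
    simp [this]
  · have h1 : supNorm (N⁻¹ • f).1 univ ≤ 1 := by
      rw [← ENNReal.ofReal_one, supNorm_le_ofReal_iff zero_le_one]
      intro x _
      change |N⁻¹ * f.1 x| ≤ 1
      rw [abs_mul, abs_of_pos (inv_pos.2 hN), inv_mul_le_iff₀ hN, mul_one]
      exact hf x
    have h2 : ‖lam (N⁻¹ • f)‖ₑ ≤ dualNorm lam :=
      le_iSup₂ (f := fun (f : V) (_ : supNorm f.1 univ ≤ 1) => ‖lam f‖ₑ) _ h1
    rw [← ofReal_norm, ENNReal.ofReal_le_iff_le_toReal hlam, map_smul, norm_smul, norm_inv,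
      Real.norm_of_nonneg hN.le, inv_mul_le_iff₀ hN, Real.norm_eq_abs] at h2
    rwa [mul_comm]

/-! ### Fill distance -/

theorem exists_dist_le_fillDistance {X : Type*} [MetricSpace X] {Ω : Set X} (hΩ : IsCompact Ω)
    {Ξ : Finset X} (hΞ : Ξ.Nonempty) {y : X} (hy : y ∈ Ω) :
    ∃ ξ ∈ Ξ, dist y ξ ≤ fillDistance (Ξ : Set X) Ω := by
  obtain ⟨ξ, hξ, hd⟩ := Ξ.finite_toSet.isCompact.exists_infDist_eq_dist hΞ y
  refine ⟨ξ, hξ, hd ▸ ?_⟩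
  have hb : BddAbove (range fun x : Ω => Metric.infDist (x : X) Ξ) := by
    have := (hΩ.image (Metric.continuous_infDist_pt (Ξ : Set X))).bddAbove
    rwa [image_eq_range] at this
  exact le_ciSup hb ⟨y, hy⟩

theorem fillDistance_pos {X : Type*} [MetricSpace X] {Ω : Set X} (hΩ : IsCompact Ω)
    (hΩ' : Ω.Infinite) {Ξ : Finset X} (hΞ : Ξ.Nonempty) : 0 < fillDistance (Ξ : Set X) Ω := by
  by_contra! h
  refine hΩ' (Ξ.finite_toSet.subset fun y hy => ?_)
  obtain ⟨ξ, hξ, hd⟩ := exists_dist_le_fillDistance hΩ hΞ hy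
  rwa [dist_le_zero.1 (hd.trans h)]

/-! ### The norming inequality and the gradient functional -/

section Norming

variable {d : ℕ} {M : Type*} [MetricSpace M] [ChartedSpace (EuclideanSpace ℝ (Fin d)) M]
  [RiemannianBundle (fun x : M => TangentSpace (𝓡 d) x)]
  {P : Submodule ℝ (M → ℝ)} {D K rs : ℝ} {Ω : Set M}
  {rf θ r Γ₁ Γ₂ : ℝ}

theorem coneFactor_pos (hΩ : InteriorConeDomain d Ω rf θ)
    (hΓ : MetricEquivalence d Ω r Γ₁ Γ₂) : 0 < coneFactor D Γ₁ θ := by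
  have hs := hΩ.sin_pos
  have hΓ0 := hΓ.pos
  unfold coneFactor
  positivity

theorem markov_constant_pos (hΩ : InteriorConeDomain d Ω rf θ)
    (hΓ : MetricEquivalence d Ω r Γ₁ Γ₂) (hκ : 0 < kappa D K Γ₁ θ) : 0 < K := by
  have hs := hΩ.sin_pos
  have hΓ0 := hΓ.pos
  have hc := coneFactor_pos (D := D) hΩ hΓ
  have : kappa D K Γ₁ θ = K * ((2 : ℝ) ^ (2 * D) * coneFactor D Γ₁ θ *
    ((1 + Γ₁ * Real.sin θ) / (Γ₁ * Real.sin θ))) := by unfold kappa; ring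
  rw [this] at hκ
  exact pos_of_mul_pos_left hκ (by positivity)

variable [IsRiemannianManifold (𝓡 d) M]

theorem exists_mul_abs_le (hP : DoublingMarkovSpace d P D K rs)
    (hΩ : InteriorConeDomain d Ω rf θ) (hr : IsDiffeoRadius d Ω r)
    (hΓ : MetricEquivalence d Ω r Γ₁ Γ₂) {κ : ℝ} (hκ : κ = kappa D K Γ₁ θ) (hκ1 : 1 ≤ κ)
    {Ξ : Set M} {h : ℝ} (hh : ∀ y ∈ Ω, ∃ ξ ∈ Ξ, dist y ξ ≤ h)
    {ε ρ : ℝ} (hε : 0 < ε) (hε1 : ε < 1) (hρ0 : 0 < ρ) (hρf : ρ ≤ rf) (hρr : ρ ≤ r)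
    (hρ : ρ < rs) (hhρ : h = ε * ρ / κ) {p : M → ℝ} (hp : p ∈ P) {x : M} (hx : x ∈ Ω) :
    ∃ ξ ∈ Ξ, dist x ξ < ρ ∧ (1 - ε) * |p x| ≤ |p ξ| := by
  have hs := hΩ.sin_pos
  have hΓ0 := hΓ.pos
  have hκ0 : 0 < κ := by linarith
  have hc := coneFactor_pos (D := D) hΩ hΓ
  have hK := markov_constant_pos hΩ hΓ (hκ ▸ hκ0)
  have hhκ : h * κ = ε * ρ := by rw [hhρ]; field_simp
  have hhlt : h < ρ := by nlinarith
  -- The main case `R = ρ / 2`: here `K * C` is `κ` without its last factor, which is at least `1`.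
  by_cases h2 : ρ / 2 + h < ρ
  · refine exists_mul_abs_le_of_growth hP hΩ.compact hh hp hx hK.le (R := ρ / 2)
      (C := 2 ^ (2 * D) * coneFactor D Γ₁ θ) (by positivity) hκ0 hε hρ0 hρ h2 hhρ ?_
      (by positivity) fun B hB =>
        abs_le_of_abs_le_inter_closedBall_half hP hΩ hr hΓ hp hx hρ0 hρf hρr hρ hB
    rw [hκ, kappa, ← mul_assoc]
    refine le_mul_of_one_le_right (by positivity) ?_
    rw [one_le_div (by positivity)]
    linarith
  have hκ2 : κ < 2 := by
    by_contra! hκ2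
    have : h * 2 ≤ h * κ := by
      have : 0 ≤ h := by rw [hhρ]; positivity
      gcongr
    nlinarith
  -- Now `κ < 2`. If `K` is small, `R = 0` suffices: `p` grows from `x` by at most `(1 - K)⁻¹`, and
  -- `K / (1 - K) ≤ κ` is exactly this condition.
  rcases le_or_gt (K * (1 + κ)) κ with hKκ | hKκ
  · have hK1 : K < 1 := by nlinarith
    refine exists_mul_abs_le_of_growth hP hΩ.compact hh hp hx hK.le (R := 0)
      (C := (1 - K)⁻¹) le_rfl hκ0 hε hρ0 hρ (by linarith) hhρ ?_
      (inv_nonneg.2 (by linarith)) fun B hB m hm => ?_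
    · rw [mul_inv_le_iff₀ (by linarith)]
      linarith
    · obtain ⟨N, hN⟩ := (hΩ.compact.image_of_continuousOn
        (hP.contMDiff p hp).continuous.abs.continuousOn).bddAbove
      have hbd := abs_le_of_abs_le_inter_closedBall_half hP hΩ hr hΓ hp hx hρ0 hρf hρr hρ
        (B := N) fun m hm => hN (mem_image_of_mem _ hm.1)
      refine (abs_le_of_markov_lt_one hP hp hK.le hK1 hρ0 hρ hbd m hm).trans ?_
      have := hB x ⟨hx, Metric.mem_closedBall_self le_rfl⟩
      have : 0 ≤ (1 - K)⁻¹ := inv_nonneg.2 (by linarith)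
      gcongr
  · by_cases hp0 : ∃ y, p y ≠ 0
    swap
    · push Not at hp0
      obtain ⟨ξ, hξ, hd⟩ := hh x hx
      exact ⟨ξ, hξ, hd.trans_lt hhlt, by simp [hp0]⟩
    obtain ⟨y, hy⟩ := hp0
    have hD := hP.exponent_nonneg hp hy
    have hΓ1 := hΓ.lower_constant_le_one hΩ hr.pos hx
    obtain ⟨hκ1', hgrowth⟩ := growth_constant_le hD hK (mul_pos hΓ0 hs)
      (mul_le_of_le_one_left hs.le hΓ1) (Real.sin_le_one θ) hκ hκ1 hκ2 hKκ
    have ha0 : 0 < 1 - 1 / κ := by rw [sub_pos, div_lt_one hκ0]; exact hκ1'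
    have ha1 : 1 - 1 / κ < 1 := by rw [sub_lt_self_iff]; positivity
    have hRρ : (1 - 1 / κ) * ρ < ρ := mul_lt_of_lt_one_left hρ0 ha1
    -- As `h = ε * ρ / κ < ρ / κ`, this radius still leaves room for `h` whenever `ε < 1`.
    refine exists_mul_abs_le_of_growth hP hΩ.compact hh hp hx hK.le (R := (1 - 1 / κ) * ρ)
      (by positivity) hκ0 hε hρ0 hρ ?_ hhρ hgrowth (by positivity) fun B hB => ?_
    · have h1 : (1 - 1 / κ) * ρ + h = ρ - (1 - ε) * ρ / κ := by rw [hhρ]; field_simp; ring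
      have h3 : 0 < (1 - ε) * ρ / κ := div_pos (mul_pos (by linarith) hρ0) hκ0
      linarith
    · have hb := abs_le_of_abs_le_inter_closedBall hP hΩ hr hΓ hp hx (mul_pos ha0 hρ0) hRρ.le
        (by linarith) (by linarith) hρ hB
      have hq : ρ * (1 + Real.sin θ) / ((1 - 1 / κ) * ρ) = (1 + Real.sin θ) / (1 - 1 / κ) := by
        rw [mul_comm ρ]
        exact mul_div_mul_right _ _ hρ0.ne'
      rwa [hq] at hb

/-- The sample maximizing `|p|` in the enlarged ball serves all `x` at once, so the uniform norm is
controlled by one sample. -/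
theorem exists_forall_abs_le (hP : DoublingMarkovSpace d P D K rs)
    (hΩ : InteriorConeDomain d Ω rf θ) (hr : IsDiffeoRadius d Ω r)
    (hΓ : MetricEquivalence d Ω r Γ₁ Γ₂) {κ : ℝ} (hκ : κ = kappa D K Γ₁ θ) (hκ1 : 1 ≤ κ)
    {Ξ : Finset M} {h : ℝ} (hh : ∀ y ∈ Ω, ∃ ξ ∈ Ξ, dist y ξ ≤ h)
    {ε ρ : ℝ} (hε : 0 < ε) (hε1 : ε < 1) (hρ0 : 0 < ρ) (hρf : ρ ≤ rf) (hρr : ρ ≤ r)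
    (hρ : ρ < rs) (hhρ : h = ε * ρ / κ) {p : M → ℝ} (hp : p ∈ P) {α : M} {r' : ℝ}
    (hα : (Metric.ball α r' ∩ Ω).Nonempty) :
    ∃ ξ ∈ Ξ, ξ ∈ Metric.ball α (r' + ρ) ∧
      ∀ x ∈ Metric.ball α r' ∩ Ω, |p x| ≤ (1 - ε)⁻¹ * |p ξ| := by
  classical
  have key : ∀ x ∈ Metric.ball α r' ∩ Ω, ∃ ξ ∈ Ξ.filter (· ∈ Metric.ball α (r' + ρ)),
      |p x| ≤ (1 - ε)⁻¹ * |p ξ| := by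
    intro x hx
    obtain ⟨ξ, hξ, hd, hle⟩ := exists_mul_abs_le hP hΩ hr hΓ hκ hκ1 (Ξ := (Ξ : Set M)) hh hε hε1
      hρ0 hρf hρr hρ hhρ hp hx.2
    refine ⟨ξ, Finset.mem_filter.2 ⟨hξ, ?_⟩, ?_⟩
    · have h1 := hx.1
      rw [Metric.mem_ball] at h1 ⊢
      rw [dist_comm] at hd
      linarith [dist_triangle ξ x α]
    · rwa [inv_mul_eq_div, le_div_iff₀ (by linarith), mul_comm]
  obtain ⟨x₀, hx₀⟩ := hα
  obtain ⟨ξ₀, hξ₀, -⟩ := key x₀ hx₀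
  obtain ⟨ξ, hξ, hmax⟩ := Finset.exists_max_image _ (fun ξ => |p ξ|) ⟨ξ₀, hξ₀⟩
  rw [Finset.mem_filter] at hξ
  refine ⟨ξ, hξ.1, hξ.2, fun x hx => ?_⟩
  obtain ⟨ξ', hξ', hle⟩ := key x hx
  have : 0 ≤ (1 - ε)⁻¹ := inv_nonneg.2 (by linarith)
  exact hle.trans (mul_le_mul_of_nonneg_left (hmax ξ' hξ') this)

/-- The functional `p ↦ ∇p(α) v` on a space of `C¹` functions. -/
noncomputable def covDerivEval (hP : DoublingMarkovSpace d P D K rs) (α : M) (v : TangentSpace (𝓡 d) α) :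
    P →ₗ[ℝ] ℝ where
  toFun p := covDeriv p.1 α v
  map_add' p q := by
    have := mfderiv_add ((hP.contMDiff p.1 p.2 α).mdifferentiableAt one_ne_zero)
      ((hP.contMDiff q.1 q.2 α).mdifferentiableAt one_ne_zero)
    exact congrArg (fun T : TangentSpace (𝓡 d) α →L[ℝ] ℝ => T v) this
  map_smul' c p := by
    have := const_smul_mfderiv ((hP.contMDiff p.1 p.2 α).mdifferentiableAt one_ne_zero) c
    exact congrArg (fun T : TangentSpace (𝓡 d) α →L[ℝ] ℝ => T v) this

theorem abs_covDeriv_apply_le (hP : DoublingMarkovSpace d P D K rs)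
    (hΩ : InteriorConeDomain d Ω rf θ) (hr : IsDiffeoRadius d Ω r)
    (hΓ : MetricEquivalence d Ω r Γ₁ Γ₂) (hK : 0 ≤ K) {p : M → ℝ} (hp : p ∈ P) {α : M}
    (hα : α ∈ Ω) {ρ B : ℝ} (hρ0 : 0 < ρ) (hρf : ρ ≤ rf) (hρr : ρ ≤ r) (hρ : ρ < rs)
    (hB : ∀ x ∈ Metric.ball α ρ ∩ Ω, |p x| ≤ B) (v : TangentSpace (𝓡 d) α) :
    |covDeriv p α v| ≤ K * (2 : ℝ) ^ (2 * D) * coneFactor D Γ₁ θ / ρ * ‖v‖ * B := by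
  have hαmem := Metric.mem_ball_self (x := α) hρ0
  have hc := coneFactor_pos (D := D) hΩ hΓ
  have hB0 : 0 ≤ B := (abs_nonneg _).trans (hB α ⟨hαmem, hα⟩)
  have hbd := abs_le_of_abs_le_inter_closedBall_half hP hΩ hr hΓ hp hα hρ0 hρf hρr hρ
    fun m hm => hB m ⟨Metric.closedBall_subset_ball (by linarith) hm.2, hm.1⟩
  have hgrad := hP.norm_covDeriv_le hp hK hρ0 hρ (by positivity) hbd α hαmem
  have h1 := (covDeriv (d := d) p α).le_of_opNorm_le hgrad v
  have h2 : ∀ n : ℝ, K / ρ * (2 ^ (2 * D) * coneFactor D Γ₁ θ * B) * n =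
      K * (2 : ℝ) ^ (2 * D) * coneFactor D Γ₁ θ / ρ * n * B := fun n => by ring
  rw [h2] at h1
  exact h1

end Norming

end LocalReproduction

/-! ### Assembly of the three statements -/

open LocalReproduction in
theorem lemma4p1 {d : ℕ} {M : Type*} [MetricSpace M] [ConnectedSpace M]
    [ChartedSpace (EuclideanSpace ℝ (Fin d)) M] [IsManifold (𝓡 d) ∞ M]
    [RiemannianBundle (fun x : M => TangentSpace (𝓡 d) x)]
    [IsContMDiffRiemannianBundle (𝓡 d) ∞ (EuclideanSpace ℝ (Fin d))
      (fun x : M => TangentSpace (𝓡 d) x)]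
    [IsRiemannianManifold (𝓡 d) M]
    (P : Submodule ℝ (M → ℝ)) (D K rSharp : ℝ)
    (hP : LocalReproduction.DoublingMarkovSpace d P D K rSharp)
    (Ω : Set M) (rFlat θ : ℝ)
    (hΩ : LocalReproduction.InteriorConeDomain d Ω rFlat θ)
    (rΩ Γ₁ Γ₂ : ℝ)
    (hrΩ : LocalReproduction.IsDiffeoRadius d Ω rΩ)
    (hΓ : LocalReproduction.MetricEquivalence d Ω rΩ Γ₁ Γ₂)
    (rstar κ : ℝ)
    (hrstar : rstar = min (min rΩ rSharp) rFlat)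
    (hκ : κ = LocalReproduction.kappa D K Γ₁ θ)
    (hκ1 : 1 ≤ κ)
    (ε : ℝ) (hε0 : 0 < ε) (hε1 : ε < 1)
    (Ξ : Finset M) (hΞ : Ξ.Nonempty) (hΞΩ : (Ξ : Set M) ⊆ Ω)
    (h : ℝ) (hh : h = LocalReproduction.fillDistance (Ξ : Set M) Ω)
    (hle : h ≤ LocalReproduction.thresholdFill ε rstar κ)
    (α : M) (hα : α ∈ Ω) :
    -- every functional on the restricted space is represented stably and locally
    (∀ lam : LocalReproduction.restrictedSpace P (Metric.ball α (κ * h) ∩ Ω) →ₗ[ℝ] ℝ,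
      ∃ a : M → ℝ,
        Function.support a ⊆ (Ξ : Set M) ∩ Metric.ball α ((1 + ε) / ε * (κ * h)) ∧
        ENNReal.ofReal (∑ ξ ∈ Ξ, |a ξ|) ≤
          ENNReal.ofReal ((1 - ε)⁻¹) * LocalReproduction.dualNorm lam ∧
        ∀ p : P, ∑ ξ ∈ Ξ, a ξ * p.1 ξ =
          lam (LocalReproduction.toRestricted P (Metric.ball α (κ * h) ∩ Ω) p)) ∧
    -- point evaluation
    (∃ a : M → ℝ,
        Function.support a ⊆ (Ξ : Set M) ∩ Metric.ball α ((1 + ε) / ε * (κ * h)) ∧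
        ∑ ξ ∈ Ξ, |a ξ| ≤ (1 - ε)⁻¹ ∧
        ∀ p ∈ P, ∑ ξ ∈ Ξ, a ξ * p ξ = p α) ∧
    -- covariant derivative in an arbitrary direction
    (∀ v : TangentSpace (𝓡 d) α, ∃ a : M → ℝ,
        Function.support a ⊆ (Ξ : Set M) ∩ Metric.ball α ((1 + ε) / ε * (κ * h)) ∧
        ∑ ξ ∈ Ξ, |a ξ| ≤ (1 - ε)⁻¹ *
          (K * (2 : ℝ) ^ (2 * D) * LocalReproduction.coneFactor D Γ₁ θ / (κ * h) * ‖v‖) ∧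
        ∀ p ∈ P, ∑ ξ ∈ Ξ, a ξ * p ξ = LocalReproduction.covDeriv p α v) := by
  have hs := hΩ.sin_pos
  have hΓ0 := hΓ.pos
  have hκ0 : 0 < κ := by linarith
  have hh0 : 0 < h := hh ▸ fillDistance_pos hΩ.compact (hΩ.infinite hrΩ hα) hΞ
  have hc := coneFactor_pos (D := D) hΩ hΓ
  have hK := markov_constant_pos hΩ hΓ (hκ ▸ hκ0)
  have h1ε : 0 < (1 - ε)⁻¹ := inv_pos.2 (by linarith)
  have hρ0 : 0 < κ * h / ε := by positivity
  have hκh : 0 < κ * h := by positivity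
  have hκhρ : κ * h ≤ κ * h / ε := le_div_self hκh.le hε0 hε1.le
  -- The threshold gives `κ * h / ε ≤ r* / (1 + ε)`, so the factor `1 + ε` makes the inequality
  -- strict.
  have hρstar : κ * h / ε < rstar := by
    rw [thresholdFill, le_div_iff₀ (by positivity)] at hle
    have hpos : 0 < rstar := by
      refine pos_of_mul_pos_right (lt_of_lt_of_le ?_ hle) hε0.le
      positivity
    rw [div_lt_iff₀ hε0]
    nlinarith
  have hρr : κ * h / ε < rΩ :=
    hρstar.trans_le (hrstar ▸ (min_le_left _ _).trans (min_le_left _ _))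
  have hρs : κ * h / ε < rSharp :=
    hρstar.trans_le (hrstar ▸ (min_le_left _ _).trans (min_le_right _ _))
  have hρf : κ * h / ε < rFlat := hρstar.trans_le (hrstar ▸ min_le_right _ _)
  have hαmem : α ∈ Metric.ball α (κ * h) ∩ Ω := ⟨Metric.mem_ball_self hκh, hα⟩
  have hrad : (1 + ε) / ε * (κ * h) = κ * h + κ * h / ε := by field_simp; ring
  rw [hrad]
  have hnorm : ∀ p : P, ∃ ξ ∈ Ξ, ξ ∈ Metric.ball α (κ * h + κ * h / ε) ∧
      ∀ x ∈ Metric.ball α (κ * h) ∩ Ω, |p.1 x| ≤ (1 - ε)⁻¹ * |p.1 ξ| := fun p =>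
    exists_forall_abs_le hP hΩ hrΩ hΓ hκ hκ1
      (fun y hy => hh ▸ exists_dist_le_fillDistance hΩ.compact hΞ hy) hε0 hε1 hρ0 hρf.le hρr.le
      hρs (by field_simp) p.2 ⟨α, hαmem⟩
  have hzero : ∀ p : P, (∀ ξ ∈ Ξ, ξ ∈ Metric.ball α (κ * h + κ * h / ε) → p.1 ξ = 0) →
      ∀ x ∈ Metric.ball α (κ * h) ∩ Ω, p.1 x = 0 := by
    intro p hp x hx
    obtain ⟨ξ, hξ, hU, hle⟩ := hnorm p
    have := hle x hx
    rw [hp ξ hξ hU, abs_zero, mul_zero] at this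
    exact abs_nonpos_iff.1 this
  refine ⟨fun lam => ?_, ?_, fun v => ?_⟩
  · obtain ⟨a, hsupp, hrep, hbd⟩ := exists_sum_abs_le_of_norming
      (lam.comp (toRestricted P (Metric.ball α (κ * h) ∩ Ω))) Ξ
      (Metric.ball α (κ * h + κ * h / ε)) fun p hp => by
        have : toRestricted P (Metric.ball α (κ * h) ∩ Ω) p = 0 := by
          ext x
          exact hzero p hp x x.2
        rw [LinearMap.comp_apply, this, map_zero]
    refine ⟨a, hsupp, ?_, hrep⟩
    by_cases hlam : dualNorm lam = ⊤
    · rw [hlam, ENNReal.mul_top (by simpa using hε1)]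
      exact le_top
    · rw [← ENNReal.ofReal_toReal hlam, ← ENNReal.ofReal_mul h1ε.le]
      refine ENNReal.ofReal_le_ofReal (hbd _ (by positivity) fun p => ?_)
      obtain ⟨ξ, hξ, hU, hle⟩ := hnorm p
      refine ⟨ξ, hξ, hU, ?_⟩
      refine (abs_le_toReal_dualNorm_mul lam hlam (fun x => hle x x.2) (by positivity)).trans ?_
      exact le_of_eq (by ring)
  · obtain ⟨a, hsupp, hrep, hbd⟩ := exists_sum_abs_le_of_norming
      ((LinearMap.proj α : (M → ℝ) →ₗ[ℝ] ℝ).comp P.subtype) Ξ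
      (Metric.ball α (κ * h + κ * h / ε)) fun p hp => hzero p hp α hαmem
    refine ⟨a, hsupp, hbd _ h1ε.le fun p => ?_, fun p hp => hrep ⟨p, hp⟩⟩
    obtain ⟨ξ, hξ, hU, hle⟩ := hnorm p
    exact ⟨ξ, hξ, hU, hle α hαmem⟩
  · set C := K * (2 : ℝ) ^ (2 * D) * coneFactor D Γ₁ θ / (κ * h) * ‖v‖
    have hC : 0 ≤ C := by positivity
    have hL : ∀ p : P, ∃ ξ ∈ Ξ, ξ ∈ Metric.ball α (κ * h + κ * h / ε) ∧
        |covDerivEval hP α v p| ≤ (1 - ε)⁻¹ * C * |p.1 ξ| := by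
      intro p
      obtain ⟨ξ, hξ, hU, hle⟩ := hnorm p
      refine ⟨ξ, hξ, hU, ?_⟩
      -- Markov is applied at radius `κ * h`, not `κ * h / ε`: `p` is controlled by one sample on
      -- `ball α (κ * h) ∩ Ω`, hence the denominator `κ * h`.
      refine (abs_covDeriv_apply_le hP hΩ hrΩ hΓ hK.le p.2 hα hκh (hκhρ.trans hρf.le)
        (hκhρ.trans hρr.le) (hκhρ.trans_lt hρs) hle v).trans (le_of_eq ?_)
      rw [mul_comm (1 - ε)⁻¹ C, mul_assoc C]
    obtain ⟨a, hsupp, hrep, hbd⟩ := exists_sum_abs_le_of_norming (covDerivEval hP α v) Ξ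
      (Metric.ball α (κ * h + κ * h / ε)) fun p hp => by
        obtain ⟨ξ, hξ, hU, hle⟩ := hL p
        rw [hp ξ hξ hU, abs_zero, mul_zero] at hle
        exact abs_nonpos_iff.1 hle
    exact ⟨a, hsupp, hbd _ (mul_nonneg h1ε.le hC) hL, fun p hp => hrep ⟨p, hp⟩⟩
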